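/- Let $G=\{(u,v):u\in\mathbb{R},\,v>0\}$ with the measure $\mathrm{d}\nu(u,v)=v^{-2}\,\mathrm{d}u\,\mathrm{d}v$, let $\hat g(\xi)=\int_{\mathbb{R}} g(x)\,\mathrm{e}^{-2\pi\mathrm{i}x\xi}\,\mathrm{d}x$ be the unitary Fourier transform on $L_2(\mathbb{R})$, and let $H_2^+(\mathbb{R})=\{f\in L_2(\mathbb{R}):\operatorname{supp}\hat f\subseteq[0,+\infty)\}$. Let $\psi^{(0)}\in L_2(\mathbb{R})$ be the wavelet with $\hat\psi^{(0)}(\xi)=\chi_{(0,\infty)}(\xi)\sqrt{2\xi}\,\mathrm{e}^{-\xi}$ and put $\psi^{(0)}_v(x)=v^{-1/2}\psi^{(0)}(x/v)$. Let $$A^{(0)}=\left\{(u,v)\mapsto (f*\psi^{(0)}_v)(u)\;:\;f\in H_2^+(\mathbb{R})\right\}\subset L_2(G,\mathrm{d}\nu).$$ This set is a closed linear subspace of $L_2(G,\mathrm{d}\nu)$; let $P^{(0)}$ be the orthogonal projection of $L_2(G,\mathrm{d}\nu)$ onto it. For $a\in L_\infty(\mathbb{R}_+)$ let $T_a^{(0)}:A^{(0)}\to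 A^{(0)}$ be the Calder\'on--Toeplitz operator $T_a^{(0)}F=P^{(0)}(aF)$, where $a=a(v)$ acts by pointwise multiplication. For a linear subspace $\mathcal{A}\subseteq L_\infty(\mathbb{R}_+)$ let $\mathcal{T}_0(\mathcal{A})$ be the $C^*$-algebra generated by the operators $T_a^{(0)}$, $a\in\mathcal{A}$, and let $L(1,a_1)$ denote the linear span of $1$ and $a_1$. Let $a_+=\chi_{[0,1/2]}$, let $\lambda>0$ and let $\Delta_\lambda(x)=1-(1-x)^{2\lambda}$ for $x\in[0,1]$. Then $T^{(0)}_{a_+}$ is self-adjoint with spectrum contained in $[0,1]$, the function $\Delta_\lambda$ is continuous on $[0,1]$ (so that $\Delta_\lambda(T^{(0)}_{a_+})$ is defined by the continuous functional calculus), and $$\Delta_\lambda\left(T^{(0)}_{a_+}\right)=T^{(0)}_{\chi_{[0,\lambda]}}\in\mathcal{T}_0\left(L(1,\chi_{[0,\lambda]})\right).$$ -/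

import Mathlib

open MeasureTheory Set
open scoped ENNReal FourierTransform Convolution

noncomputable section

namespace CalderonToeplitz

/-- The measure `v⁻² dv` on the half-line `ℝ₊ = (0, ∞)`, as a measure on `ℝ`. -/
def scaleMeasure : Measure ℝ :=
  (volume.restrict (Ioi (0 : ℝ))).withDensity fun v => ENNReal.ofReal (v ^ 2)⁻¹

/-- The left Haar measure `dν(u, v) = v⁻² du dv` of the affine group
`G = {(u, v) : u ∈ ℝ, v > 0}`, as a measure on `ℝ × ℝ` carried by `G`. -/
def haarG : Measure (ℝ × ℝ) := (volume : Measure ℝ).prod scaleMeasure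

/-- The Hilbert space `L₂(G, dν)`. -/
abbrev L2G : Type := Lp ℂ 2 haarG

/-- The algebra `L_∞(ℝ₊)` of symbols that depend on the scale `v` only. -/
abbrev VerticalSymbol : Type := Lp ℂ ∞ (volume.restrict (Ioi (0 : ℝ)))

/-- The Laguerre polynomial `L_k(y) = ∑ᵢ (-1)ⁱ (k choose k - i) yⁱ / i!` (of type `0`). -/
def laguerrePoly (k : ℕ) (y : ℝ) : ℝ :=
  ∑ i ∈ Finset.range (k + 1), (-1) ^ i * (k.choose (k - i) : ℝ) * (y ^ i / (i.factorial : ℝ))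

/-- The Laguerre function `ℓ_k(y) = e^{-y/2} L_k(y)`. -/
def laguerreFun (k : ℕ) (y : ℝ) : ℝ := Real.exp (-y / 2) * laguerrePoly k y

/-- The Fourier transform `χ₊(ξ) √(2ξ) ℓ_k(2ξ)` of the wavelet `ψ⁽ᵏ⁾`. -/
def waveletHat (k : ℕ) : ℝ → ℂ :=
  (Ioi (0 : ℝ)).indicator fun ξ => ((Real.sqrt (2 * ξ) * laguerreFun k (2 * ξ) : ℝ) : ℂ)

/-- The wavelet `ψ⁽ᵏ⁾`, the inverse Fourier transform
`ψ⁽ᵏ⁾(x) = ∫ (waveletHat k)(ξ) e^{2πixξ} dξ` of the integrable function `waveletHat k`. -/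
def wavelet (k : ℕ) : ℝ → ℂ := 𝓕⁻ (waveletHat k)

/-- The dilation `ψ_v(u) = v^{-1/2} ψ(u / v)`. -/
def dilate (v : ℝ) (ψ : ℝ → ℂ) (u : ℝ) : ℂ := (((Real.sqrt v)⁻¹ : ℝ) : ℂ) * ψ (u / v)

/-- The Hardy space `H₂⁺(ℝ)`: the square-integrable functions whose Fourier transform
is supported in `[0, ∞)`. -/
def hardyPlus : Set (Lp ℂ 2 (volume : Measure ℝ)) :=
  {f | ∀ᵐ ξ : ℝ, ξ < 0 → 𝓕 f ξ = 0}

/-- The continuous wavelet transform `(W_k f)(u, v) = (f * ψ_v⁽ᵏ⁾)(u)`. -/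
def waveletTransform (k : ℕ) (f : ℝ → ℂ) (z : ℝ × ℝ) : ℂ :=
  (f ⋆[ContinuousLinearMap.mul ℂ ℂ, volume] dilate z.2 (wavelet k)) z.1

/-- The set of all wavelet transforms `W_k f` with `f ∈ H₂⁺(ℝ)`, inside `L₂(G, dν)`. -/
def waveletTransforms (k : ℕ) : Set L2G :=
  {F | ∃ f ∈ hardyPlus, F =ᵐ[haarG] waveletTransform k f}

/-- The wavelet subspace `A⁽ᵏ⁾` of `L₂(G, dν)`, formed as the closed linear span of the wavelet
transforms `W_k f`, `f ∈ H₂⁺(ℝ)`, so that it is a Hilbert space by construction.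
(The set of these transforms is itself a closed subspace, so nothing is added to it.) -/
def waveletSubspace (k : ℕ) : Submodule ℂ L2G :=
  (Submodule.span ℂ (waveletTransforms k)).topologicalClosure

/-- `A⁽ᵏ⁾` as a Hilbert space, with the inner product of `L₂(G, dν)`. -/
def WaveletSpace (k : ℕ) : Type := waveletSubspace k

instance instCompleteSpaceWaveletSubspace (k : ℕ) : CompleteSpace (waveletSubspace k) :=
  (Submodule.isClosed_topologicalClosure _).completeSpace_coe

instance instNormedAddCommGroupWaveletSpace (k : ℕ) : NormedAddCommGroup (WaveletSpace k) :=
  inferInstanceAs (NormedAddCommGroup (waveletSubspace k))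

instance instInnerProductSpaceWaveletSpace (k : ℕ) : InnerProductSpace ℂ (WaveletSpace k) :=
  inferInstanceAs (InnerProductSpace ℂ (waveletSubspace k))

instance instCompleteSpaceWaveletSpace (k : ℕ) : CompleteSpace (WaveletSpace k) :=
  inferInstanceAs (CompleteSpace (waveletSubspace k))

/-- The inclusion of `A⁽ᵏ⁾` in `L₂(G, dν)`. -/
def waveletIncl (k : ℕ) : WaveletSpace k →L[ℂ] L2G := (waveletSubspace k).subtypeL

/-- The orthogonal projection `P⁽ᵏ⁾` of `L₂(G, dν)` onto `A⁽ᵏ⁾`. -/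
def waveletProj (k : ℕ) : L2G →L[ℂ] WaveletSpace k :=
  (waveletSubspace k).orthogonalProjectionOnto

/-- The operator `M_a` of multiplication by `a ∈ L_∞(G)` on `L₂(G, dν)`. -/
def mulOp (a : Lp ℂ ∞ haarG) : L2G →L[ℂ] L2G :=
  (ContinuousLinearMap.mul ℂ ℂ).holderL haarG ∞ 2 2 a

/-- The operator `F ↦ P⁽ᵏ⁾ (a F)` on `A⁽ᵏ⁾` with symbol `a ∈ L_∞(G)`. -/
def toeplitzOp (k : ℕ) (a : Lp ℂ ∞ haarG) : WaveletSpace k →L[ℂ] WaveletSpace k :=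
  waveletProj k ∘L mulOp a ∘L waveletIncl k

lemma quasiMeasurePreserving_snd :
    Measure.QuasiMeasurePreserving (Prod.snd : ℝ × ℝ → ℝ) haarG
      (volume.restrict (Ioi (0 : ℝ))) :=
  Measure.quasiMeasurePreserving_snd.mono_right (withDensity_absolutelyContinuous _ _)

lemma memLp_vertical (a : VerticalSymbol) :
    MemLp (fun z : ℝ × ℝ => a z.2) ∞ haarG := by
  have h := Lp.memLp a
  refine memLp_top_of_bound
    (h.1.comp_quasiMeasurePreserving quasiMeasurePreserving_snd) ‖a‖ ?_
  have h2 : ∀ᵐ v ∂(volume.restrict (Ioi (0 : ℝ))), ‖a v‖ ≤ ‖a‖ := by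
    filter_upwards [ae_le_eLpNormEssSup (f := a) (μ := volume.restrict (Ioi (0 : ℝ)))] with v hv
    rw [Lp.norm_def, ← toReal_enorm]
    refine ENNReal.toReal_mono (Lp.eLpNorm_ne_top a) ?_
    simpa [eLpNorm_exponent_top] using hv
  exact quasiMeasurePreserving_snd.ae h2

/-- The symbol `(u, v) ↦ a(v)` on `G`. -/
def vertical (a : VerticalSymbol) : Lp ℂ ∞ haarG := (memLp_vertical a).toLp _

/-- The Calderón–Toeplitz operator `T_a⁽ᵏ⁾ : A⁽ᵏ⁾ → A⁽ᵏ⁾` with symbol `a = a(v)`. -/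
def calderonToeplitz (k : ℕ) (a : VerticalSymbol) :
    WaveletSpace k →L[ℂ] WaveletSpace k :=
  toeplitzOp k (vertical a)

/-- The `C*`-algebra `𝒯_k(𝒜)` generated by the operators `T_a⁽ᵏ⁾` with symbols `a ∈ 𝒜`: the
norm closure of the `*`-algebra which they generate. -/
def toeplitzAlgebra (k : ℕ) (𝒜 : Submodule ℂ VerticalSymbol) :
    NonUnitalStarSubalgebra ℂ (WaveletSpace k →L[ℂ] WaveletSpace k) :=
  (NonUnitalStarAlgebra.adjoin ℂ (calderonToeplitz k '' 𝒜)).topologicalClosure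

/-- The constant symbol `1`. -/
def oneSymbol : VerticalSymbol := (memLp_top_const (1 : ℂ)).toLp fun _ => (1 : ℂ)

lemma memLp_cutoff (l : ℝ) : MemLp ((Icc 0 l).indicator fun _ : ℝ => (1 : ℂ)) ∞
    (volume.restrict (Ioi (0 : ℝ))) :=
  (memLp_top_const (1 : ℂ)).indicator measurableSet_Icc

/-- The symbol `χ_{[0, l]}`. -/
def cutoffSymbol (l : ℝ) : VerticalSymbol := (memLp_cutoff l).toLp _

/-- The linear space `L(1, a₁)` generated by `1` and `a₁`. -/
def symbolSpan (a₁ : VerticalSymbol) : Submodule ℂ VerticalSymbol :=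
  Submodule.span ℂ {oneSymbol, a₁}

/-- The function `Δ_l(x) = 1 - (1 - x)^{2l}`, used for `x ∈ [0, 1]`. -/
def Delta (l x : ℝ) : ℝ := 1 - (1 - x) ^ (2 * l)

end CalderonToeplitz

end

/-!
On the frequency side the wavelet transform of `f ∈ H₂⁺(ℝ)` at the scale `v` is the multiplication
of `𝓕 f` by `ψ̂_v(ξ) = v √(2ξ) e^{-vξ}`, `ξ > 0`, followed by the inverse Fourier transform
(`waveletTransform_eq_freqTransform`). Plancherel's theorem on each horizontal line and Tonelli's
theorem then give, for a transform `F` of `f` and a measurable set `S` of scales,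
`∫_{v ∈ S} |F|² dν = ∫_0^∞ |𝓕 f(ξ)|² (∫_S 2ξ e^{-2ξv} dv) dξ` (`setLIntegral_freqTransform`).

For `S = ℝ₊` the inner integral is `1`. So the transform is an isometry `freqIsometry` of `L²(ℝ₊)`
into `L₂(G, dν)`, and its range, which is the set of wavelet transforms, is closed.
For `S = [0, l]` the inner integral is `1 - e^{-2lξ}`. So `T_{χ_{[0, l]}}` has the same quadratic
form as, hence is unitarily equivalent to, the multiplication by
`1 - e^{-2lξ} = Δ_l(1 - e^{-ξ})` on `L²(ℝ₊)` (`calderonToeplitz_cutoff`). Since `Δ_{1/2}(x) = x`,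
the operators `T_{χ_{[0, 1/2]}}` and `T_{χ_{[0, l]}}` are the images of `x` and of `Δ_l` under one
continuous representation `toeplitzHom` of `C([0, 1], ℝ)`, and such a representation commutes with
the continuous functional calculus (`cfc_map_continuousMap`).
-/

namespace CalderonToeplitz

/-! ### The inverse Fourier integral on `L¹ ∩ L²` -/

lemma continuous_fourierInv_of_integrable {g : ℝ → ℂ} (hg : Integrable g) :
    Continuous (𝓕⁻ g) :=
  VectorFourier.fourierIntegral_continuous (L := -innerₗ ℝ) Real.continuous_fourierChar
    (continuous_inner (𝕜 := ℝ) (E := ℝ)).neg hg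

/-- On `L¹ ∩ L²` the inverse Fourier transform of `L²`, an extension by continuity, is given by
the inverse Fourier integral: both define the same tempered distribution. -/
theorem fourierInv_toLp_ae_eq {g : ℝ → ℂ} (h1 : Integrable g) (h2 : MemLp g 2) :
    (𝓕⁻ (h2.toLp g) : Lp ℂ 2 (volume : Measure ℝ)) =ᵐ[volume] 𝓕⁻ g := by
  apply ae_eq_of_integral_contDiff_smul_eq
  · exact (Lp.memLp _).locallyIntegrable (by norm_num)
  · exact (continuous_fourierInv_of_integrable h1).locallyIntegrable
  intro φ hφ hφc
  have hc : HasCompactSupport (Complex.ofRealCLM ∘ φ) := hφc.comp_left rfl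
  have hs : ContDiff ℝ ((⊤ : ℕ∞) : WithTop ℕ∞) (Complex.ofRealCLM ∘ φ) := by fun_prop
  set Φ : SchwartzMap ℝ ℂ := hc.toSchwartzMap hs with hΦ
  have hd := congrArg (fun T => T Φ) (Lp.fourierInv_toTemperedDistribution_eq (h2.toLp g))
  simp only [TemperedDistribution.fourierInv_apply, Lp.toTemperedDistribution_apply] at hd
  have e1 : ∫ x, φ x • (𝓕⁻ (h2.toLp g) : Lp ℂ 2 (volume : Measure ℝ)) x
      = ∫ x, (𝓕⁻ Φ) x • (h2.toLp g) x := by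
    rw [hd]
    simp [hΦ]
  have e2 : ∫ x, (𝓕⁻ Φ) x • (h2.toLp g) x = ∫ x, (𝓕⁻ Φ) x • g x := by
    refine integral_congr_ae ?_
    filter_upwards [h2.coeFn_toLp] with x hx
    rw [hx]
  have e3 : ∫ x, (𝓕⁻ Φ) x • g x = ∫ x, Φ x • 𝓕⁻ g x := by
    rw [SchwartzMap.fourierInv_coe]
    have := VectorFourier.integral_fourierIntegral_smul_eq_flip (μ := volume) (ν := volume)
      (L := -innerₗ ℝ) (f := Φ) (g := g) Real.continuous_fourierChar
      (continuous_inner (𝕜 := ℝ) (E := ℝ)).neg Φ.integrable h1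
    have hflip : (-innerₗ ℝ).flip = -innerₗ ℝ := by
      ext
      simp
    rw [hflip] at this
    exact this
  rw [e1, e2, e3]
  simp [hΦ]

/-- Plancherel's theorem for the inverse Fourier integral on `L¹ ∩ L²`. -/
theorem lintegral_enorm_sq_fourierInv {g : ℝ → ℂ} (h1 : Integrable g) (h2 : MemLp g 2) :
    ∫⁻ u, ‖𝓕⁻ g u‖ₑ ^ 2 = ∫⁻ ξ, ‖g ξ‖ₑ ^ 2 := by
  have key : eLpNorm (𝓕⁻ g) 2 volume = eLpNorm g 2 volume := by
    rw [← eLpNorm_congr_ae (fourierInv_toLp_ae_eq h1 h2), ← eLpNorm_congr_ae h2.coeFn_toLp,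
      ← Lp.enorm_def, ← Lp.enorm_def]
    exact congrArg ENNReal.ofNNReal
      (NNReal.eq ((Lp.fourierTransformₗᵢ ℝ ℂ).symm.norm_map (h2.toLp g)))
  have h := congrArg (fun t => t ^ (2 : ℝ)) key
  simp only [eLpNorm_eq_lintegral_rpow_enorm_toReal two_ne_zero ENNReal.ofNat_ne_top,
    ENNReal.toReal_ofNat, ← ENNReal.rpow_mul] at h
  simpa using h

/-! ### The dilated wavelet and its Fourier transform -/

/-- The Fourier transform `v √(2ξ) e^{-vξ}`, `ξ > 0`, of the dilated wavelet `ψ_v⁽⁰⁾`, extended by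
zero to `ξ ≤ 0`. -/
noncomputable def dilatedHat (v : ℝ) : ℝ → ℂ :=
  (Ioi (0 : ℝ)).indicator fun ξ => ((v * √(2 * ξ) * Real.exp (-(v * ξ)) : ℝ) : ℂ)

lemma measurable_dilatedHat : Measurable fun p : ℝ × ℝ => dilatedHat p.1 p.2 := by
  have : (fun p : ℝ × ℝ => dilatedHat p.1 p.2) = (Prod.snd ⁻¹' Ioi (0 : ℝ)).indicator
      fun p => ((p.1 * √(2 * p.2) * Real.exp (-(p.1 * p.2)) : ℝ) : ℂ) := by
    ext p
    simp [dilatedHat, indicator]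
  rw [this]
  refine Measurable.indicator ?_ (measurable_snd measurableSet_Ioi)
  fun_prop

lemma dilatedHat_eq {v : ℝ} (hv : 0 < v) (ξ : ℝ) :
    dilatedHat v ξ = (√v : ℂ) * waveletHat 0 (v * ξ) := by
  by_cases hξ : 0 < ξ
  · have h : (v * ξ) ∈ Ioi (0 : ℝ) := mul_pos hv hξ
    rw [dilatedHat, waveletHat, indicator_of_mem (mem_Ioi.2 hξ), indicator_of_mem h,
      ← Complex.ofReal_mul]
    congr 1
    have h1 : √(2 * (v * ξ)) = √v * √(2 * ξ) := by
      rw [← Real.sqrt_mul hv.le]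
      ring_nf
    have h2 : laguerreFun 0 (2 * (v * ξ)) = Real.exp (-(v * ξ)) := by
      simp only [laguerreFun, laguerrePoly]
      simp
      ring
    rw [h1, h2, ← mul_assoc, ← mul_assoc, Real.mul_self_sqrt hv.le]
  · have h : ¬ (v * ξ) ∈ Ioi (0 : ℝ) := by
      simpa [hv] using hξ
    rw [dilatedHat, waveletHat, indicator_of_notMem (by simpa using hξ), indicator_of_notMem h,
      mul_zero]

lemma dilatedHat_of_pos (v : ℝ) {ξ : ℝ} (hξ : 0 < ξ) :
    dilatedHat v ξ = ((v * √(2 * ξ) * Real.exp (-(v * ξ)) : ℝ) : ℂ) :=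
  indicator_of_mem (mem_Ioi.2 hξ) _

lemma dilatedHat_of_nonpos (v : ℝ) {ξ : ℝ} (hξ : ξ ≤ 0) : dilatedHat v ξ = 0 :=
  indicator_of_notMem (by simpa using hξ) _

lemma norm_dilatedHat_sq (v : ℝ) {ξ : ℝ} (hξ : 0 < ξ) :
    ‖dilatedHat v ξ‖ ^ 2 = v ^ 2 * (2 * ξ * Real.exp (-(2 * ξ) * v)) := by
  rw [dilatedHat_of_pos v hξ, Complex.norm_real, Real.norm_eq_abs, sq_abs, mul_pow, mul_pow,
    Real.sq_sqrt (by positivity), ← Real.exp_nat_mul]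
  push_cast
  ring_nf

lemma aestronglyMeasurable_dilatedHat (v : ℝ) (μ : Measure ℝ) :
    AEStronglyMeasurable (dilatedHat v) μ :=
  (measurable_dilatedHat.comp measurable_prodMk_left).aestronglyMeasurable

lemma integrable_dilatedHat {v : ℝ} (hv : 0 < v) : Integrable (dilatedHat v) := by
  refine (integrable_indicator_iff measurableSet_Ioi).2 (Integrable.ofReal
    (f := fun ξ => v * √(2 * ξ) * Real.exp (-(v * ξ))) ?_)
  have h := (integrableOn_rpow_mul_exp_neg_mul_rpow (s := 1 / 2) (p := 1) (by norm_num) one_pos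
    hv).const_mul (v * √2)
  refine IntegrableOn.congr_fun h (fun ξ hξ => ?_) measurableSet_Ioi
  have : (0 : ℝ) < ξ := hξ
  simp only [Real.rpow_one]
  rw [Real.sqrt_mul zero_le_two, Real.sqrt_eq_rpow ξ]
  ring_nf

lemma memLp_two_dilatedHat {v : ℝ} (hv : 0 < v) : MemLp (dilatedHat v) 2 := by
  refine (memLp_two_iff_integrable_sq_norm (aestronglyMeasurable_dilatedHat v _)).2 ?_
  have h := (integrableOn_rpow_mul_exp_neg_mul_rpow (s := 1) (p := 1) (b := 2 * v) (by norm_num)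
    one_pos (by positivity)).const_mul (v ^ 2 * 2)
  refine ((integrable_indicator_iff measurableSet_Ioi).2 h).congr (ae_of_all _ fun ξ => ?_)
  beta_reduce
  rcases lt_or_ge 0 ξ with hξ | hξ
  · rw [indicator_of_mem (mem_Ioi.2 hξ), norm_dilatedHat_sq v hξ]
    simp only [Real.rpow_one]
    ring_nf
  · rw [indicator_of_notMem (by simpa using hξ), dilatedHat_of_nonpos v hξ]
    simp

lemma memLp_top_dilatedHat {v : ℝ} (hv : 0 < v) : MemLp (dilatedHat v) ∞ := by
  refine memLp_top_of_bound (aestronglyMeasurable_dilatedHat v _) (√v) (ae_of_all _ fun ξ => ?_)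
  refine Real.le_sqrt_of_sq_le ?_
  rcases lt_or_ge 0 ξ with hξ | hξ
  · rw [norm_dilatedHat_sq v hξ]
    have h := Real.add_one_le_exp (2 * ξ * v)
    have h2 : 2 * ξ * v * Real.exp (-(2 * ξ * v)) ≤ 1 := by
      rw [Real.exp_neg, ← div_eq_mul_inv, div_le_one (Real.exp_pos _)]
      linarith
    calc v ^ 2 * (2 * ξ * Real.exp (-(2 * ξ) * v))
        = v * (2 * ξ * v * Real.exp (-(2 * ξ * v))) := by ring_nf
      _ ≤ v * 1 := by gcongr
      _ = v := mul_one v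
  · rw [dilatedHat_of_nonpos v hξ]
    simpa using hv.le

/-- The dilated wavelet is the inverse Fourier transform of `dilatedHat v`. -/
lemma dilate_wavelet_eq {v : ℝ} (hv : 0 < v) (u : ℝ) :
    dilate v (wavelet 0) u = 𝓕⁻ (dilatedHat v) u := by
  have h := Measure.integral_comp_mul_left
    (fun η : ℝ => Complex.exp (2 * Real.pi * (η * (u / v)) * Complex.I) * waveletHat 0 η) v
  simp only [dilate, wavelet, Real.fourierInv_eq', smul_eq_mul, RCLike.inner_apply, conj_trivial]
  have e : ∀ ξ : ℝ, Complex.exp (((2 * Real.pi * (u * ξ) : ℝ) : ℂ) * Complex.I) * dilatedHat v ξ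
      = (√v : ℂ) * (Complex.exp (2 * Real.pi * (((v * ξ : ℝ) : ℂ) * (u / v)) * Complex.I)
        * waveletHat 0 (v * ξ)) := by
    intro ξ
    rw [dilatedHat_eq hv]
    have : (v : ℂ) ≠ 0 := by exact_mod_cast hv.ne'
    have e' : (((2 * Real.pi * (u * ξ) : ℝ) : ℂ) * Complex.I)
      = 2 * Real.pi * (((v * ξ : ℝ) : ℂ) * (u / v)) * Complex.I := by
      push_cast
      field_simp
    rw [e']
    ring
  simp_rw [e]
  rw [integral_const_mul, h, abs_of_pos (inv_pos.2 hv), Complex.real_smul, ← mul_assoc,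
    ← Complex.ofReal_mul]
  congr 1
  · congr 1
    rw [inv_eq_iff_eq_inv, mul_inv, inv_inv, ← div_eq_inv_mul, Real.div_sqrt]
  · congr 1
    ext η
    congr 2
    push_cast
    ring

/-! ### The wavelet transform on the frequency side -/

/-- The wavelet transform of the function with Fourier transform `g`: at the scale `v` it is the
inverse Fourier transform of `ξ ↦ ψ̂_v(ξ) g(ξ)`. Only the values of `g` on `(0, ∞)` matter. -/
noncomputable def freqTransform (g : ℝ → ℂ) (z : ℝ × ℝ) : ℂ :=
  𝓕⁻ (fun ξ => dilatedHat z.2 ξ * g ξ) z.1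

/-- Parseval's identity turns the convolution with `ψ_v` into a multiplication by `ψ̂_v`. -/
theorem waveletTransform_eq_freqTransform (f : Lp ℂ 2 (volume : Measure ℝ)) {z : ℝ × ℝ}
    (hz : 0 < z.2) : waveletTransform 0 f z = freqTransform (𝓕 f : Lp ℂ 2 volume) z := by
  obtain ⟨u, v⟩ := z
  simp only at hz
  -- `q` is chosen so that the conjugate of `𝓕⁻ q` is the kernel `t ↦ ψ_v(u - t)`.
  set q : ℝ → ℂ := fun ξ => Complex.exp (((-(2 * Real.pi * (u * ξ)) : ℝ) : ℂ) * Complex.I)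
    * dilatedHat v ξ with hq
  have hqm : ∀ p, MemLp (dilatedHat v) p → MemLp q p := fun p hp => by
    refine hp.of_le ((by fun_prop : Measurable fun ξ : ℝ =>
      Complex.exp (((-(2 * Real.pi * (u * ξ)) : ℝ) : ℂ) * Complex.I)).aestronglyMeasurable.mul
      (aestronglyMeasurable_dilatedHat v _)) (ae_of_all _ fun ξ => ?_)
    rw [hq, norm_mul, Complex.norm_exp_ofReal_mul_I, one_mul]
  have hreal : ∀ ξ, (starRingEnd ℂ) (dilatedHat v ξ) = dilatedHat v ξ := fun ξ => by
    rcases lt_or_ge 0 ξ with hξ | hξ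
    · rw [dilatedHat_of_pos v hξ, Complex.conj_ofReal]
    · rw [dilatedHat_of_nonpos v hξ, map_zero]
  have h1 : Integrable q := memLp_one_iff_integrable.1
    (hqm 1 (memLp_one_iff_integrable.2 (integrable_dilatedHat hz)))
  have h2 : MemLp q 2 := hqm 2 (memLp_two_dilatedHat hz)
  have hconj : ∀ t, (starRingEnd ℂ) (𝓕⁻ q t) = dilate v (wavelet 0) (u - t) := fun t => by
    rw [dilate_wavelet_eq hz, Real.fourierInv_eq', Real.fourierInv_eq', ← integral_conj]
    refine integral_congr_ae (ae_of_all _ fun ξ => ?_)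
    simp only [hq, smul_eq_mul, map_mul, hreal, ← Complex.exp_conj, Complex.conj_ofReal,
      Complex.conj_I, RCLike.inner_apply, conj_trivial]
    rw [← mul_assoc, ← Complex.exp_add]
    congr 2
    push_cast
    ring
  have hP := Lp.inner_fourier_eq (𝓕⁻ (h2.toLp q) : Lp ℂ 2 (volume : Measure ℝ)) f
  rw [FourierTransform.fourier_fourierInv_eq, L2.inner_def, L2.inner_def] at hP
  calc waveletTransform 0 f (u, v) = ∫ t, f t * dilate v (wavelet 0) (u - t) := rfl
    _ = ∫ t, inner ℂ ((𝓕⁻ (h2.toLp q) : Lp ℂ 2 (volume : Measure ℝ)) t) (f t) := by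
      refine integral_congr_ae ?_
      filter_upwards [fourierInv_toLp_ae_eq h1 h2] with t ht
      rw [ht, RCLike.inner_apply, hconj]
    _ = ∫ ξ, inner ℂ (h2.toLp q ξ) ((𝓕 f : Lp ℂ 2 volume) ξ) := hP.symm
    _ = _ := by
      rw [freqTransform, Real.fourierInv_eq']
      refine integral_congr_ae ?_
      filter_upwards [h2.coeFn_toLp] with ξ hξ
      rw [hξ, RCLike.inner_apply, hq]
      simp only [map_mul, hreal, ← Complex.exp_conj, Complex.conj_ofReal, Complex.conj_I,
        smul_eq_mul, RCLike.inner_apply, conj_trivial]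
      push_cast
      ring_nf

lemma dilatedHat_mul_eq_indicator (v : ℝ) (g : ℝ → ℂ) :
    (fun ξ => dilatedHat v ξ * g ξ) = (Ioi 0).indicator fun ξ => dilatedHat v ξ * g ξ := by
  ext ξ
  by_cases hξ : 0 < ξ
  · rw [indicator_of_mem (mem_Ioi.2 hξ)]
  · rw [indicator_of_notMem (by simpa using hξ), dilatedHat_of_nonpos v (not_lt.1 hξ), zero_mul]

lemma integrable_dilatedHat_mul {g : ℝ → ℂ} (hg : MemLp g 2 (volume.restrict (Ioi 0))) {v : ℝ}
    (hv : 0 < v) : Integrable fun ξ => dilatedHat v ξ * g ξ := by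
  rw [dilatedHat_mul_eq_indicator, integrable_indicator_iff measurableSet_Ioi]
  exact (memLp_two_dilatedHat hv).restrict _ |>.integrable_mul hg

lemma memLp_dilatedHat_mul {g : ℝ → ℂ} (hg : MemLp g 2 (volume.restrict (Ioi 0))) {v : ℝ}
    (hv : 0 < v) : MemLp (fun ξ => dilatedHat v ξ * g ξ) 2 := by
  rw [dilatedHat_mul_eq_indicator, memLp_indicator_iff_restrict measurableSet_Ioi]
  exact hg.mul' ((memLp_top_dilatedHat hv).restrict _)

lemma freqTransform_congr {g g' : ℝ → ℂ} (h : g =ᵐ[volume.restrict (Ioi 0)] g') :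
    freqTransform g = freqTransform g' := by
  ext z
  refine Real.fourierInv_congr_ae ?_ _
  filter_upwards [(ae_restrict_iff' measurableSet_Ioi).1 h] with ξ hξ
  rcases lt_or_ge 0 ξ with h0 | h0
  · rw [hξ h0]
  · rw [dilatedHat_of_nonpos _ h0, zero_mul, zero_mul]

lemma freqTransform_add {g g' : ℝ → ℂ} (hg : MemLp g 2 (volume.restrict (Ioi 0)))
    (hg' : MemLp g' 2 (volume.restrict (Ioi 0))) {z : ℝ × ℝ} (hz : 0 < z.2) :
    freqTransform (g + g') z = freqTransform g z + freqTransform g' z := by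
  simp only [freqTransform, Real.fourierInv_eq, Pi.add_apply, mul_add, smul_add]
  refine integral_add ?_ ?_
  · simpa using (Real.fourierIntegral_convergent_iff (-z.1)).2 (integrable_dilatedHat_mul hg hz)
  · simpa using (Real.fourierIntegral_convergent_iff (-z.1)).2 (integrable_dilatedHat_mul hg' hz)

lemma freqTransform_smul (c : ℂ) (g : ℝ → ℂ) (z : ℝ × ℝ) :
    freqTransform (c • g) z = c * freqTransform g z := by
  simp only [freqTransform, Real.fourierInv_eq, Pi.smul_apply, smul_eq_mul]
  rw [← integral_const_mul]
  refine integral_congr_ae (ae_of_all _ fun ξ => ?_)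
  simp only [Circle.smul_def, smul_eq_mul]
  ring

lemma stronglyMeasurable_freqTransform {g : ℝ → ℂ} (hg : Measurable g) :
    StronglyMeasurable (freqTransform g) := by
  have : freqTransform g = fun z => ∫ ξ, Complex.exp (((2 * Real.pi * (z.1 * ξ) : ℝ) : ℂ)
      * Complex.I) * (dilatedHat z.2 ξ * g ξ) := by
    ext z
    simp [freqTransform, Real.fourierInv_eq', mul_comm z.1]
  rw [this]
  refine StronglyMeasurable.integral_prod_right' (f := fun p : (ℝ × ℝ) × ℝ =>
    Complex.exp (((2 * Real.pi * (p.1.1 * p.2) : ℝ) : ℂ) * Complex.I) *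
      (dilatedHat p.1.2 p.2 * g p.2)) (Measurable.stronglyMeasurable ?_)
  refine Measurable.mul (by fun_prop) (Measurable.mul ?_ (hg.comp measurable_snd))
  exact measurable_dilatedHat.comp ((measurable_snd.comp measurable_fst).prodMk measurable_snd)

lemma lintegral_freqTransform_fiber {g : ℝ → ℂ} (hg : MemLp g 2 (volume.restrict (Ioi 0))) {v : ℝ}
    (hv : 0 < v) : ∫⁻ u, ‖freqTransform g (u, v)‖ₑ ^ 2 =
      ∫⁻ ξ in Ioi 0, ‖dilatedHat v ξ‖ₑ ^ 2 * ‖g ξ‖ₑ ^ 2 := by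
  rw [← lintegral_indicator measurableSet_Ioi]
  refine (lintegral_enorm_sq_fourierInv (integrable_dilatedHat_mul hg hv)
    (memLp_dilatedHat_mul hg hv)).trans (lintegral_congr fun ξ => ?_)
  rcases lt_or_ge 0 ξ with h0 | h0
  · rw [indicator_of_mem (mem_Ioi.2 h0), enorm_mul, mul_pow]
  · rw [indicator_of_notMem (by simpa using h0), dilatedHat_of_nonpos _ h0]
    simp

/-! ### The energy of a wavelet transform -/

/-- The density `∫_S 2ξ e^{-2ξv} dv` at the frequency `ξ` of the energy that a wavelet transform
has at the scales in `S`; it is the spectral function of the Toeplitz operator with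
symbol `χ_S`. -/
noncomputable def scaleWeight (S : Set ℝ) (ξ : ℝ) : ℝ≥0∞ :=
  ∫⁻ v in S ∩ Ioi 0, ENNReal.ofReal (2 * ξ * Real.exp (-(2 * ξ) * v))

instance instSFiniteScaleMeasure : SFinite scaleMeasure := by
  unfold scaleMeasure
  infer_instance

/-- Plancherel's theorem on each horizontal line and Tonelli's theorem give the energy of a
wavelet transform at the scales in `S`. -/
theorem setLIntegral_freqTransform {g : ℝ → ℂ} (hgm : Measurable g)
    (hg : MemLp g 2 (volume.restrict (Ioi 0))) {S : Set ℝ} (hS : MeasurableSet S) :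
    ∫⁻ z in univ ×ˢ S, ‖freqTransform g z‖ₑ ^ 2 ∂haarG =
      ∫⁻ ξ in Ioi 0, scaleWeight S ξ * ‖g ξ‖ₑ ^ 2 := by
  have hSI : MeasurableSet (S ∩ Ioi (0 : ℝ)) := hS.inter measurableSet_Ioi
  have hw : Measurable fun v : ℝ => ENNReal.ofReal (v ^ 2)⁻¹ := by fun_prop
  have hF : Measurable fun z : ℝ × ℝ => ‖freqTransform g z‖ₑ ^ 2 :=
    (stronglyMeasurable_freqTransform hgm).measurable.enorm.pow_const 2
  have hk : Measurable fun p : ℝ × ℝ => ENNReal.ofReal (p.1 ^ 2)⁻¹ *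
      (‖dilatedHat p.1 p.2‖ₑ ^ 2 * ‖g p.2‖ₑ ^ 2) :=
    (hw.comp measurable_fst).mul ((measurable_dilatedHat.enorm.pow_const 2).mul
      ((hgm.comp measurable_snd).enorm.pow_const 2))
  rw [haarG, ← Measure.prod_restrict, Measure.restrict_univ, lintegral_prod_symm' _ hF,
    scaleMeasure, restrict_withDensity hS, Measure.restrict_restrict hS,
    lintegral_withDensity_eq_lintegral_mul _ hw (hF.lintegral_prod_left')]
  calc _ = ∫⁻ v in S ∩ Ioi 0, ∫⁻ ξ in Ioi 0, ENNReal.ofReal (v ^ 2)⁻¹ *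
        (‖dilatedHat v ξ‖ₑ ^ 2 * ‖g ξ‖ₑ ^ 2) := by
        refine setLIntegral_congr_fun hSI fun v hv => ?_
        rw [Pi.mul_apply, lintegral_freqTransform_fiber hg hv.2, lintegral_const_mul']
        exact ENNReal.ofReal_ne_top
    _ = ∫⁻ ξ in Ioi 0, ∫⁻ v in S ∩ Ioi 0, ENNReal.ofReal (v ^ 2)⁻¹ *
        (‖dilatedHat v ξ‖ₑ ^ 2 * ‖g ξ‖ₑ ^ 2) := lintegral_lintegral_swap hk.aemeasurable
    _ = _ := by
        refine setLIntegral_congr_fun measurableSet_Ioi fun ξ hξ => ?_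
        have hξ0 : (0 : ℝ) < ξ := hξ
        rw [scaleWeight, ← lintegral_mul_const' _ _ (by finiteness)]
        refine setLIntegral_congr_fun hSI fun v hv => ?_
        have hv0 : (0 : ℝ) < v := hv.2
        rw [← mul_assoc, ← ofReal_norm, ← ENNReal.ofReal_pow (norm_nonneg _),
          ← ENNReal.ofReal_mul (by positivity), norm_dilatedHat_sq v hξ0]
        congr 2
        field_simp

lemma scaleWeight_univ {ξ : ℝ} (hξ : 0 < ξ) : scaleWeight univ ξ = 1 := by
  rw [scaleWeight, univ_inter, ← ofReal_integral_eq_lintegral_ofReal]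
  · rw [integral_const_mul, integral_exp_mul_Ioi (by linarith)]
    simp
    field_simp
  · exact (integrableOn_exp_mul_Ioi (by linarith) 0).const_mul _
  · exact ae_of_all _ fun v => by positivity

lemma scaleWeight_Icc {l ξ : ℝ} (hl : 0 < l) (hξ : 0 < ξ) :
    scaleWeight (Icc 0 l) ξ = ENNReal.ofReal (1 - Real.exp (-(2 * l * ξ))) := by
  have hI : Icc 0 l ∩ Ioi 0 = Ioc 0 l := by
    ext v
    simp only [mem_inter_iff, mem_Icc, mem_Ioi, mem_Ioc]
    constructor
    · rintro ⟨h1, h2⟩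
      exact ⟨h2, h1.2⟩
    · rintro ⟨h1, h2⟩
      exact ⟨⟨h1.le, h2⟩, h1⟩
  have hd : ∀ v : ℝ, HasDerivAt (fun v => -Real.exp (-(2 * ξ) * v))
      (2 * ξ * Real.exp (-(2 * ξ) * v)) v := fun v => by
    have := (((hasDerivAt_id v).const_mul (-(2 * ξ))).exp).neg
    simp only [id] at this
    convert! this using 1
    ring
  have hc : Continuous fun v : ℝ => 2 * ξ * Real.exp (-(2 * ξ) * v) := by fun_prop
  rw [scaleWeight, hI, ← ofReal_integral_eq_lintegral_ofReal]
  · rw [← intervalIntegral.integral_of_le hl.le,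
      intervalIntegral.integral_eq_sub_of_hasDerivAt (fun v _ => hd v) (hc.intervalIntegrable _ _)]
    congr 1
    simp
    ring_nf
  · exact hc.integrableOn_Ioc
  · exact ae_of_all _ fun v => by positivity

/-! ### Multiplication operators on `L²` -/

section Multiplication

variable {α X : Type*} [MeasurableSpace α] (μ : Measure α) [TopologicalSpace X] [CompactSpace X]
  [MeasurableSpace X] [BorelSpace X]

lemma memLp_top_comp {γ : α → X} (hγ : Measurable γ) (f : C(X, ℝ)) :
    MemLp (fun x => (f (γ x) : ℂ)) ∞ μ :=
  memLp_top_of_bound (Complex.measurable_ofReal.comp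
    (f.continuous.measurable.comp hγ)).aestronglyMeasurable ‖f‖
    (ae_of_all _ fun _ => by simpa using f.norm_coe_le_norm _)

/-- The operator of multiplication by `f ∘ γ` on `L²(μ)`. -/
noncomputable def compMulOp {γ : α → X} (hγ : Measurable γ) (f : C(X, ℝ)) :
    Lp ℂ 2 μ →L[ℂ] Lp ℂ 2 μ :=
  (ContinuousLinearMap.mul ℂ ℂ).holderL μ ∞ 2 2 ((memLp_top_comp μ hγ f).toLp _)

lemma coeFn_compMulOp {γ : α → X} (hγ : Measurable γ) (f : C(X, ℝ)) (h : Lp ℂ 2 μ) :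
    compMulOp μ hγ f h =ᵐ[μ] fun x => (f (γ x) : ℂ) * h x := by
  have h1 := (ContinuousLinearMap.mul ℂ ℂ).coeFn_holder (r := 2)
    ((memLp_top_comp μ hγ f).toLp _) h
  filter_upwards [h1, (memLp_top_comp μ hγ f).coeFn_toLp] with x hx hx'
  rw [compMulOp, ContinuousLinearMap.holderL_apply_apply, hx, hx']
  rfl

/-- The representation of `C(X, ℝ)` on `L²(μ)` by the operators of multiplication by `f ∘ γ`. -/
noncomputable def compMulHom {γ : α → X} (hγ : Measurable γ) :
    C(X, ℝ) →⋆ₐ[ℝ] (Lp ℂ 2 μ →L[ℂ] Lp ℂ 2 μ) where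
  toFun := compMulOp μ hγ
  map_one' := by
    ext h
    filter_upwards [coeFn_compMulOp μ hγ 1 h] with x hx
    rw [hx]
    simp
  map_mul' f g := by
    ext h
    rw [mul_apply_eq_comp]
    filter_upwards [coeFn_compMulOp μ hγ (f * g) h, coeFn_compMulOp μ hγ g h,
      coeFn_compMulOp μ hγ f (compMulOp μ hγ g h)] with x hx hx' hx''
    rw [hx, hx'', hx', ContinuousMap.mul_apply, Complex.ofReal_mul, mul_assoc]
  map_zero' := by
    ext h
    rw [zero_apply]
    filter_upwards [coeFn_compMulOp μ hγ 0 h, Lp.coeFn_zero ℂ 2 μ] with x hx hx'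
    rw [hx, hx']
    simp
  map_add' f g := by
    ext h
    rw [add_apply]
    filter_upwards [coeFn_compMulOp μ hγ (f + g) h, coeFn_compMulOp μ hγ f h,
      coeFn_compMulOp μ hγ g h, Lp.coeFn_add (compMulOp μ hγ f h) (compMulOp μ hγ g h)]
      with x hx hx' hx'' hs
    rw [hx, hs, Pi.add_apply, hx', hx'', ContinuousMap.add_apply, Complex.ofReal_add, add_mul]
  commutes' c := by
    ext h
    rw [Algebra.algebraMap_eq_smul_one, Algebra.algebraMap_eq_smul_one,
      smul_apply, one_apply_eq_self]
    filter_upwards [coeFn_compMulOp μ hγ (c • 1) h, Lp.coeFn_smul c h] with x hx hx'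
    rw [hx, hx']
    simp
  map_star' f := by
    rw [star_trivial, ContinuousLinearMap.star_eq_adjoint, ContinuousLinearMap.eq_adjoint_iff]
    intro h k
    rw [L2.inner_def, L2.inner_def]
    refine integral_congr_ae ?_
    filter_upwards [coeFn_compMulOp μ hγ f h, coeFn_compMulOp μ hγ f k] with x hx hx'
    rw [hx, hx']
    simp only [RCLike.inner_apply, map_mul, Complex.conj_ofReal]
    ring

lemma compMulHom_apply {γ : α → X} (hγ : Measurable γ) (f : C(X, ℝ)) :
    compMulHom μ hγ f = compMulOp μ hγ f := rfl

lemma continuous_compMulHom {γ : α → X} (hγ : Measurable γ) : Continuous (compMulHom μ hγ) := by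
  refine AddMonoidHomClass.continuous_of_bound _ 1 fun f => ?_
  rw [one_mul]
  refine ContinuousLinearMap.opNorm_le_bound _ (norm_nonneg f) fun h => ?_
  refine Lp.norm_le_mul_norm_of_ae_le_mul ?_
  filter_upwards [coeFn_compMulOp μ hγ f h] with x hx
  rw [compMulHom_apply, hx, norm_mul, Complex.norm_real]
  gcongr
  exact f.norm_coe_le_norm _

/-- The quadratic form of the multiplication by a nonnegative function. -/
lemma inner_compMulHom {γ : α → X} (hγ : Measurable γ) (f : C(X, ℝ)) (hf : 0 ≤ f)
    (h : Lp ℂ 2 μ) : inner ℂ (compMulHom μ hγ f h) h =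
      ((∫⁻ x, ENNReal.ofReal (f (γ x)) * ‖h x‖ₑ ^ 2 ∂μ).toReal : ℂ) := by
  have hm : AEStronglyMeasurable (fun x => f (γ x) * ‖h x‖ ^ 2) μ :=
    ((f.continuous.measurable.comp hγ).aestronglyMeasurable).mul
      ((Lp.aestronglyMeasurable h).norm.pow 2)
  have hn : ∀ x, 0 ≤ f (γ x) := fun x => hf (γ x)
  have e : ∫⁻ x, ENNReal.ofReal (f (γ x)) * ‖h x‖ₑ ^ 2 ∂μ =
      ∫⁻ x, ENNReal.ofReal (f (γ x) * ‖h x‖ ^ 2) ∂μ := by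
    refine lintegral_congr fun x => ?_
    rw [ENNReal.ofReal_mul (hn x), ENNReal.ofReal_pow (norm_nonneg _), ofReal_norm]
  rw [e, ← integral_eq_lintegral_of_nonneg_ae
    (ae_of_all _ fun x => mul_nonneg (hn x) (by positivity)) hm, ← integral_complex_ofReal,
    L2.inner_def]
  refine integral_congr_ae ?_
  filter_upwards [coeFn_compMulOp μ hγ f h] with x hx
  rw [compMulHom_apply, hx, RCLike.inner_apply, map_mul, Complex.conj_ofReal, mul_left_comm,
    RCLike.mul_conj]
  push_cast
  rfl

end Multiplication

/-! ### Functional calculus for the images of continuous functions -/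

/-- A continuous representation `Ψ` of `C(X, ℝ)` intertwines composition with the continuous
functional calculus. Both sides of the last identity are continuous homomorphisms in
`p ∈ C(range a, ℝ)` which agree on the identity function. -/
theorem cfc_map_continuousMap {X B : Type*} [TopologicalSpace X] [CompactSpace X]
    [Ring B] [StarRing B] [TopologicalSpace B] [Algebra ℝ B]
    [ContinuousFunctionalCalculus ℝ B IsSelfAdjoint] [ContinuousMap.UniqueHom ℝ B]
    (Ψ : C(X, ℝ) →⋆ₐ[ℝ] B) (hΨ : Continuous Ψ) (a : C(X, ℝ)) :
    IsSelfAdjoint (Ψ a) ∧ spectrum ℝ (Ψ a) ⊆ range a ∧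
      ∀ (p : ℝ → ℝ) (c : C(X, ℝ)), ContinuousOn p (range a) → (∀ x, c x = p (a x)) →
        cfc p (Ψ a) = Ψ c := by
  have hsa : IsSelfAdjoint (Ψ a) := (IsSelfAdjoint.all a).map Ψ
  have hsp : spectrum ℝ (Ψ a) ⊆ range a :=
    (AlgHom.spectrum_apply_subset Ψ a).trans (ContinuousMap.spectrum_eq_range a).le
  refine ⟨hsa, hsp, fun p c hp hc => ?_⟩
  have hK : CompactSpace (range a) := isCompact_iff_compactSpace.1 (isCompact_range a.continuous)
  -- `α` is `a` onto its range, `ι` the inclusion of the spectrum of `Ψ a` in that range.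
  let α : C(X, range a) := ⟨rangeFactorization a, a.continuous.subtype_mk _⟩
  let ι : C(spectrum ℝ (Ψ a), range a) := ⟨inclusion hsp, continuous_inclusion hsp⟩
  have key : (cfcHom hsa).comp (ContinuousMap.compStarAlgHom' ℝ ℝ ι) =
      Ψ.comp (ContinuousMap.compStarAlgHom' ℝ ℝ α) := by
    refine ContinuousMap.UniqueHom.eq_of_continuous_of_map_id _ _ _ ?_ ?_ ?_
    · exact (cfcHom_continuous hsa).comp (ContinuousMap.continuous_precomp ι)
    · exact hΨ.comp (ContinuousMap.continuous_precomp α)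
    · exact (cfcHom_id hsa).trans rfl
  rw [cfc_apply p (Ψ a) hsa (hp.mono hsp)]
  have h := DFunLike.congr_fun key ⟨_, hp.domRestrict⟩
  refine Eq.trans ?_ (h.trans ?_)
  · rfl
  · refine congrArg Ψ ?_
    ext x
    exact (hc x).symm

/-! ### The wavelet transform as an isometry -/

lemma ae_haarG_snd_pos : ∀ᵐ z ∂haarG, 0 < z.2 :=
  quasiMeasurePreserving_snd.ae (ae_restrict_mem measurableSet_Ioi)

lemma ae_haarG_of_ae_vertical {p : ℝ → Prop} (h : ∀ᵐ v ∂(volume.restrict (Ioi (0 : ℝ))), p v) :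
    ∀ᵐ z ∂haarG, p z.2 :=
  quasiMeasurePreserving_snd.ae h

/-- The Hilbert space `L²(ℝ₊)` of the Fourier transforms of the functions in `H₂⁺(ℝ)`. -/
abbrev FreqSpace : Type := Lp ℂ 2 (volume.restrict (Ioi (0 : ℝ)))

lemma setLIntegral_freqTransform_coe (h : FreqSpace) {S : Set ℝ} (hS : MeasurableSet S) :
    ∫⁻ z in univ ×ˢ S, ‖freqTransform h z‖ₑ ^ 2 ∂haarG =
      ∫⁻ ξ in Ioi 0, scaleWeight S ξ * ‖h ξ‖ₑ ^ 2 :=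
  setLIntegral_freqTransform (Lp.stronglyMeasurable h).measurable (Lp.memLp h) hS

lemma lintegral_freqTransform (h : FreqSpace) :
    ∫⁻ z, ‖freqTransform h z‖ₑ ^ 2 ∂haarG = ∫⁻ ξ in Ioi 0, ‖h ξ‖ₑ ^ 2 := by
  have := setLIntegral_freqTransform_coe h MeasurableSet.univ
  rw [univ_prod_univ, Measure.restrict_univ] at this
  rw [this]
  refine setLIntegral_congr_fun measurableSet_Ioi fun ξ hξ => ?_
  simp [scaleWeight_univ hξ]

lemma eLpNorm_freqTransform (h : FreqSpace) :
    eLpNorm (freqTransform h) 2 haarG = eLpNorm h 2 (volume.restrict (Ioi 0)) := by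
  simp only [eLpNorm_eq_lintegral_rpow_enorm_toReal two_ne_zero ENNReal.ofNat_ne_top,
    ENNReal.toReal_ofNat, ENNReal.rpow_ofNat]
  rw [lintegral_freqTransform]

lemma memLp_freqTransform (h : FreqSpace) : MemLp (freqTransform h) 2 haarG :=
  ⟨(stronglyMeasurable_freqTransform (Lp.stronglyMeasurable h).measurable).aestronglyMeasurable,
    (eLpNorm_freqTransform h).trans_lt (Lp.eLpNorm_lt_top h)⟩

/-- The wavelet transform on the frequency side as an isometry of `L²(ℝ₊)` into `L²(G, dν)`. -/
noncomputable def freqIsometry : FreqSpace →ₗᵢ[ℂ] L2G where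
  toFun h := (memLp_freqTransform h).toLp _
  map_add' h k := by
    rw [← MemLp.toLp_add]
    refine MemLp.toLp_congr _ _ ?_
    filter_upwards [ae_haarG_snd_pos] with z hz
    rw [Pi.add_apply, ← freqTransform_add (Lp.memLp h) (Lp.memLp k) hz,
      freqTransform_congr (Lp.coeFn_add h k)]
  map_smul' c h := by
    rw [RingHom.id_apply, ← MemLp.toLp_const_smul]
    refine MemLp.toLp_congr _ _ (ae_of_all _ fun z => ?_)
    rw [freqTransform_congr (Lp.coeFn_smul c h), freqTransform_smul]
    rfl
  norm_map' h := by
    change ‖(memLp_freqTransform h).toLp _‖ = ‖h‖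
    rw [Lp.norm_toLp, eLpNorm_freqTransform, Lp.norm_def]

lemma coeFn_freqIsometry (h : FreqSpace) : freqIsometry h =ᵐ[haarG] freqTransform h :=
  (memLp_freqTransform h).coeFn_toLp

/-! ### The wavelet space as the range of the isometry -/

/-- A function in `L²(ℝ₊)`, extended by zero, is the Fourier transform of a function in
`H₂⁺(ℝ)`, and only the restriction of `𝓕 f` to `ℝ₊` enters into the wavelet transform of `f`. -/
theorem range_freqIsometry : range freqIsometry = waveletTransforms 0 := by
  ext F
  constructor
  · rintro ⟨h, rfl⟩
    have hm : MemLp ((Ioi (0 : ℝ)).indicator h) 2 :=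
      (memLp_indicator_iff_restrict measurableSet_Ioi).2 (Lp.memLp h)
    have hf : 𝓕 (𝓕⁻ (hm.toLp _) : Lp ℂ 2 (volume : Measure ℝ)) = hm.toLp _ :=
      FourierTransform.fourier_fourierInv_eq _
    refine ⟨𝓕⁻ (hm.toLp _), ?_, ?_⟩
    · change ∀ᵐ ξ : ℝ, ξ < 0 → (𝓕 (𝓕⁻ (hm.toLp _) : Lp ℂ 2 (volume : Measure ℝ)) :
        Lp ℂ 2 (volume : Measure ℝ)) ξ = 0
      rw [hf]
      filter_upwards [hm.coeFn_toLp] with ξ hξ hneg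
      rw [hξ, indicator_of_notMem (by simpa using hneg.le)]
    · have hc : freqTransform (hm.toLp _) = freqTransform h := by
        refine freqTransform_congr ?_
        filter_upwards [ae_restrict_of_ae hm.coeFn_toLp, ae_restrict_mem measurableSet_Ioi]
          with ξ hξ hpos
        rw [hξ, indicator_of_mem hpos]
      filter_upwards [coeFn_freqIsometry h, ae_haarG_snd_pos] with z hz hpos
      rw [hz, waveletTransform_eq_freqTransform _ hpos, hf, hc]
  · rintro ⟨f, -, hF⟩
    have hm : MemLp (𝓕 f : Lp ℂ 2 (volume : Measure ℝ)) 2 (volume.restrict (Ioi 0)) :=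
      (Lp.memLp _).restrict _
    refine ⟨hm.toLp _, Lp.ext ?_⟩
    filter_upwards [coeFn_freqIsometry (hm.toLp _), hF, ae_haarG_snd_pos] with z hz hz' hpos
    rw [hz, hz', waveletTransform_eq_freqTransform f hpos, freqTransform_congr hm.coeFn_toLp]

lemma waveletSubspace_zero : waveletSubspace 0 = LinearMap.range freqIsometry.toLinearMap := by
  have h : waveletTransforms 0 = (LinearMap.range freqIsometry.toLinearMap : Set L2G) :=
    range_freqIsometry.symm
  rw [waveletSubspace, h, Submodule.span_eq]
  refine IsClosed.submodule_topologicalClosure_eq ?_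
  exact freqIsometry.isometry.isClosedEmbedding.isClosed_range

/-- The unitary operator of `L²(ℝ₊)` onto the wavelet space. -/
noncomputable def freqEquiv : FreqSpace ≃ₗᵢ[ℂ] WaveletSpace 0 :=
  freqIsometry.equivRange.trans (LinearIsometryEquiv.ofEq _ _ waveletSubspace_zero.symm)

lemma waveletIncl_freqEquiv (h : FreqSpace) : waveletIncl 0 (freqEquiv h) = freqIsometry h := rfl

/-! ### Toeplitz operators with cutoff symbols -/

lemma inner_toeplitzOp (k : ℕ) (a : Lp ℂ ∞ haarG) (F G : WaveletSpace k) :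
    inner ℂ (toeplitzOp k a F) G = inner ℂ (mulOp a (waveletIncl k F)) (waveletIncl k G) :=
  Submodule.inner_orthogonalProjectionOnto_eq_of_mem_right (K := waveletSubspace k) G _

lemma coeFn_mulOp_cutoff (l : ℝ) (F : L2G) :
    mulOp (vertical (cutoffSymbol l)) F =ᵐ[haarG] (univ ×ˢ Icc 0 l).indicator F := by
  have h1 := (ContinuousLinearMap.mul ℂ ℂ).coeFn_holder (r := 2) (vertical (cutoffSymbol l)) F
  filter_upwards [h1, (memLp_vertical (cutoffSymbol l)).coeFn_toLp,
    ae_haarG_of_ae_vertical (memLp_cutoff l).coeFn_toLp] with z hz hz' hz''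
  rw [mulOp, ContinuousLinearMap.holderL_apply_apply, hz, vertical, hz', cutoffSymbol, hz'']
  by_cases hzl : z.2 ∈ Icc 0 l
  · simp [indicator, hzl]
  · simp [indicator, hzl]

/-- The quadratic form of a Toeplitz operator with the symbol `χ_{[0, l]}`. -/
theorem inner_calderonToeplitz_cutoff {l : ℝ} (hl : 0 < l) (h : FreqSpace) :
    inner ℂ (calderonToeplitz 0 (cutoffSymbol l) (freqEquiv h)) (freqEquiv h) =
      ((∫⁻ ξ in Ioi 0, ENNReal.ofReal (1 - Real.exp (-(2 * l * ξ))) * ‖h ξ‖ₑ ^ 2).toReal : ℂ) := by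
  have hS : MeasurableSet ((univ : Set ℝ) ×ˢ Icc 0 l) := MeasurableSet.univ.prod measurableSet_Icc
  have e : ∫⁻ ξ in Ioi 0, ENNReal.ofReal (1 - Real.exp (-(2 * l * ξ))) * ‖h ξ‖ₑ ^ 2
      = ∫⁻ z in univ ×ˢ Icc 0 l, ‖freqIsometry h z‖ₑ ^ 2 ∂haarG := by
    calc _ = ∫⁻ ξ in Ioi 0, scaleWeight (Icc 0 l) ξ * ‖h ξ‖ₑ ^ 2 :=
          setLIntegral_congr_fun measurableSet_Ioi fun ξ hξ => by
            simp only [scaleWeight_Icc hl hξ]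
      _ = _ := (setLIntegral_freqTransform_coe h measurableSet_Icc).symm
      _ = _ := lintegral_congr_ae (ae_restrict_of_ae (by
          filter_upwards [coeFn_freqIsometry h] with z hz
          rw [hz]))
  have hm : AEStronglyMeasurable (freqIsometry h) (haarG.restrict (univ ×ˢ Icc 0 l)) :=
    (Lp.aestronglyMeasurable _).restrict
  rw [calderonToeplitz, inner_toeplitzOp, waveletIncl_freqEquiv, L2.inner_def, e]
  have e2 : ∫⁻ z in univ ×ˢ Icc 0 l, ‖freqIsometry h z‖ₑ ^ 2 ∂haarG =
      ∫⁻ z in univ ×ˢ Icc 0 l, ENNReal.ofReal (‖freqIsometry h z‖ ^ 2) ∂haarG := by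
    refine lintegral_congr fun z => ?_
    rw [ENNReal.ofReal_pow (norm_nonneg _), ofReal_norm]
  rw [e2, ← integral_eq_lintegral_of_nonneg_ae (ae_of_all _ fun z => by positivity)
    (f := fun z => ‖freqIsometry h z‖ ^ 2) (hm.norm.pow 2),
    ← integral_complex_ofReal, ← integral_indicator hS]
  refine integral_congr_ae ?_
  filter_upwards [coeFn_mulOp_cutoff l (freqIsometry h)] with z hz
  rw [hz]
  by_cases hzl : z ∈ (univ : Set ℝ) ×ˢ Icc 0 l
  · rw [indicator_of_mem hzl, indicator_of_mem hzl, inner_self_eq_norm_sq_to_K]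
    simp
  · rw [indicator_of_notMem hzl, indicator_of_notMem hzl, inner_zero_left]

/-! ### The spectral representation of the Toeplitz operators -/

lemma continuous_Delta {l : ℝ} (hl : 0 < l) : Continuous (Delta l) :=
  continuous_const.sub ((continuous_const.sub continuous_id).rpow_const fun _ =>
    Or.inr (by positivity))

/-- `Δ_l` as a continuous function on `[0, 1]`. -/
noncomputable def deltaMap {l : ℝ} (hl : 0 < l) : C(Icc (0 : ℝ) 1, ℝ) :=
  ⟨fun x => Delta l x, (continuous_Delta hl).comp continuous_subtype_val⟩

lemma deltaMap_nonneg {l : ℝ} (hl : 0 < l) : 0 ≤ deltaMap hl := fun x =>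
  sub_nonneg.2 (Real.rpow_le_one (sub_nonneg.2 x.2.2) (sub_le_self 1 x.2.1) (by positivity))

/-- The spectral function `ξ ↦ 1 - e^{-ξ}` of the Toeplitz operator with symbol `χ_{[0, 1/2]}`.
The projection onto `[0, 1]` changes it at `ξ < 0` only. -/
noncomputable def spectralParam (ξ : ℝ) : Icc (0 : ℝ) 1 :=
  projIcc 0 1 zero_le_one (1 - Real.exp (-ξ))

lemma measurable_spectralParam : Measurable spectralParam :=
  (continuous_projIcc.comp (by fun_prop)).measurable

lemma deltaMap_spectralParam {l : ℝ} (hl : 0 < l) {ξ : ℝ} (hξ : 0 < ξ) :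
    deltaMap hl (spectralParam ξ) = 1 - Real.exp (-(2 * l * ξ)) := by
  have h : (1 - Real.exp (-ξ)) ∈ Icc (0 : ℝ) 1 :=
    ⟨sub_nonneg.2 (Real.exp_le_one_iff.2 (by linarith)), sub_le_self 1 (Real.exp_pos _).le⟩
  simp only [deltaMap, spectralParam, ContinuousMap.coe_mk, projIcc_of_mem _ h, Delta,
    sub_sub_cancel]
  rw [← Real.exp_mul]
  ring_nf

/-- The representation of `C([0, 1], ℝ)` on the wavelet space which is unitarily equivalent to
the multiplication by `p(1 - e^{-ξ})` on `L²(ℝ₊)`. -/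
noncomputable def toeplitzHom :
    C(Icc (0 : ℝ) 1, ℝ) →⋆ₐ[ℝ] (WaveletSpace 0 →L[ℂ] WaveletSpace 0) :=
  ((freqEquiv.conjStarAlgEquiv :
    (FreqSpace →L[ℂ] FreqSpace) →⋆ₐ[ℂ] (WaveletSpace 0 →L[ℂ] WaveletSpace 0)).restrictScalars
      ℝ).comp (compMulHom (volume.restrict (Ioi (0 : ℝ))) measurable_spectralParam)

lemma toeplitzHom_apply_freqEquiv (p : C(Icc (0 : ℝ) 1, ℝ)) (h : FreqSpace) :
    toeplitzHom p (freqEquiv h) = freqEquiv (compMulHom _ measurable_spectralParam p h) :=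
  congrArg (fun k => freqEquiv (compMulHom _ measurable_spectralParam p k))
    (freqEquiv.symm_apply_apply h)

lemma continuous_toeplitzHom : Continuous toeplitzHom :=
  freqEquiv.toContinuousLinearEquiv.conjContinuousAlgEquiv.continuous.comp
    (continuous_compMulHom _ measurable_spectralParam)

/-- The Toeplitz operator with symbol `χ_{[0, l]}` is unitarily equivalent to the multiplication
by `1 - e^{-2lξ} = Δ_l(1 - e^{-ξ})`: both have the same quadratic form. -/
theorem calderonToeplitz_cutoff {l : ℝ} (hl : 0 < l) :
    calderonToeplitz 0 (cutoffSymbol l) = toeplitzHom (deltaMap hl) := by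
  refine ContinuousLinearMap.coe_injective ((ext_inner_map _ _).1 fun w => ?_)
  obtain ⟨h, rfl⟩ := freqEquiv.surjective w
  rw [ContinuousLinearMap.coe_coe, ContinuousLinearMap.coe_coe, toeplitzHom_apply_freqEquiv,
    LinearIsometryEquiv.inner_map_map, inner_compMulHom _ _ _ (deltaMap_nonneg hl),
    inner_calderonToeplitz_cutoff hl]
  congr 2
  refine setLIntegral_congr_fun measurableSet_Ioi fun ξ hξ => ?_
  simp only [deltaMap_spectralParam hl hξ]

end CalderonToeplitz

open CalderonToeplitz in
theorem mainTheorem6 (l : ℝ) (hl : 0 < l) :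
    ((waveletSubspace 0 : Set L2G) = waveletTransforms 0) ∧
    IsSelfAdjoint (calderonToeplitz 0 (cutoffSymbol (1 / 2))) ∧
    spectrum ℝ (calderonToeplitz 0 (cutoffSymbol (1 / 2))) ⊆ Icc 0 1 ∧
    ContinuousOn (Delta l) (Icc 0 1) ∧
    cfc (Delta l) (calderonToeplitz 0 (cutoffSymbol (1 / 2))) =
      calderonToeplitz 0 (cutoffSymbol l) ∧
    calderonToeplitz 0 (cutoffSymbol l) ∈ toeplitzAlgebra 0 (symbolSpan (cutoffSymbol l)) := by
  have hhalf : ∀ x, deltaMap (one_half_pos (α := ℝ)) x = x := fun x => by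
    simp [deltaMap, Delta]
  have hrange : range (deltaMap (one_half_pos (α := ℝ))) ⊆ Icc 0 1 := by
    rintro _ ⟨x, rfl⟩
    rw [hhalf]
    exact x.2
  obtain ⟨hsa, hsp, hcfc⟩ := cfc_map_continuousMap toeplitzHom continuous_toeplitzHom
    (deltaMap (one_half_pos (α := ℝ)))
  rw [← calderonToeplitz_cutoff] at hsa hsp hcfc
  refine ⟨?_, hsa, hsp.trans hrange, (continuous_Delta hl).continuousOn, ?_, ?_⟩
  · rw [waveletSubspace_zero, ← range_freqIsometry]
    rfl
  · rw [calderonToeplitz_cutoff hl]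
    exact hcfc (Delta l) (deltaMap hl) (continuous_Delta hl).continuousOn fun x => by
      rw [hhalf]
      rfl
  · refine NonUnitalStarSubalgebra.le_topologicalClosure _
      (NonUnitalStarAlgebra.subset_adjoin ℂ _ (mem_image_of_mem _ ?_))
    exact Submodule.subset_span (mem_insert_of_mem _ rfl)
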